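/- Conventions. Let $\kappa$ be a regular uncountable cardinal and $X$ a set with $|X|\ge\kappa$. $\mathscr P_\kappa X$ is the set of all $x\subseteq X$ with $|x|<\kappa$; $H(\theta)$ is the set of all sets whose transitive closure has size $<\theta$. A family $C\subseteq\mathscr P_\kappa X$ is cofinal if every $x\in\mathscr P_\kappa X$ is included in some $y\in C$; it is a club (resp. strong club) if it is cofinal and $\bigcup D\in C$ for every nonempty $\subseteq$-chain $D\subseteq C$ (resp. every nonempty $D\subseteq C$) with $|D|<\kappa$. A subset of $\mathscr P_\kappa X$ is stationary (resp. weakly stationary) if it meets every club (resp. strong club). For $X\subseteq X'$ and $\mathcal Y\subseteq\mathscr P_\kappa X$, let $\mathcal Y\uparrow\mathscr P_\kappa X'=\{y\in\mathscr P_\kappa X' : y\cap X\in\mathcal Y\}$. Slender tree properties. Let $\mu\le\kappa$ be an uncountable cardinal and $\mathcal Y\subseteq\mathscr P_\kappa X$. A $(\kappa,X)$-list is a sequence $D=\langle d_x : x\in\mathscr P_\kappa X\rangle$ with $d_x\subseteq x$. A set $d\subseteq X$ is a cofinal branch of $D$ if for every $x\in\mathscr P_\kappa X$ there is $z\in\mathscr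 P_\kappa X$ with $z\supseteq x$ and $d\cap x=d_z\cap x$. $D$ is $\mu$-$\mathcal Y$-slender if for all sufficiently large cardinals $\theta$ there is a club $C\subseteq\mathscr P_\kappa H(\theta)$ such that $d_{M\cap X}\cap y\in M$ for all $M\in C$ with $M\cap X\in\mathcal Y$ and all $y\in M\cap\mathscr P_\mu X$. $D$ is strongly $\mu$-$\mathcal Y$-slender if for all sufficiently large regular $\theta$ there is a strong club $C\subseteq\mathscr P_\kappa H(\theta)$ such that for all $M\in C$ with $M\cap X\in\mathcal Y$ and all $y\in M\cap\mathscr P_\mu X$ there is $e\in M$ with $d_{M\cap X}\cap y=e\cap y$. $\mathsf{SP}_{\mathcal Y}(\mu,\kappa,X)$ (resp. $\mathsf{wSP}_{\mathcal Y}(\mu,\kappa,X)$) says that every $\mu$-$\mathcal Y$-slender (resp. strongly $\mu$-$\mathcal Y$-slender) $(\kappa,X)$-list has a cofinal branch. Almost guessing. Let $\theta\ge\kappa$ be regular and $\mathcal Y\subseteq\mathscr P_\kappa H(\theta)$. For $M\subseteq H(\theta)$ and $x\in M$, a set $d\subseteq x$ is $(\mu,M)$-approximated if for every $z\in M\cap\mathscr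 P_\mu(x)$ there is $e\in M$ with $d\cap z=e\cap z$; it is $N$-guessed if there is $e\in N$ with $d\cap N=e\cap N$. For a cofinal $S\subseteq\mathscr P_\kappa H(\theta)$, $(M,x)$ is almost $\mu$-guessed by $S$ if $x\in M$ and for every $(\mu,M)$-approximated $d\subseteq x$ there is $N\in S$ with $x\in N\subseteq M$ such that $d$ is $N$-guessed. $\mathsf{AGP}_{\mathcal Y}(\mu,\kappa,\theta)$ (resp. $\mathsf{wAGP}_{\mathcal Y}(\mu,\kappa,\theta)$) says that for every cofinal $S\subseteq\mathscr P_\kappa H(\theta)$ and every $x\in H(\theta)$, the set of $M\in\mathcal Y$ such that $(M,x)$ is almost $\mu$-guessed by $S$ is stationary (resp. weakly stationary) in $\mathscr P_\kappa H(\theta)$. In all these principles, an omitted $\mathcal Y$ is the whole of $\mathscr P_\kappa X$, respectively $\mathscr P_\kappa H(\theta)$. Theorem. Let $\mu\le\kappa$ be uncountable cardinals with $\kappa$ regular. (1) $\mathsf{SP}(\mu,\kappa,\lambda)$ holds for all cardinals $\lambda\ge\kappa$ if and only if $\mathsf{AGP}(\mu,\kappa,\theta)$ holds for all regular $\theta\ge\kappa$.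 (2) $\mathsf{wSP}(\mu,\kappa,\lambda)$ holds for all cardinals $\lambda\ge\kappa$ if and only if $\mathsf{wAGP}(\mu,\kappa,\theta)$ holds for all regular $\theta\ge\kappa$. (3) Let $\theta\ge\kappa$ be regular and $\mathcal Y\subseteq\mathscr P_\kappa H(\theta)$. If $\mathcal Y$ is stationary and $\mathsf{SP}_{\mathcal Y}(\mu,\kappa,H(\theta))$ holds, then $\mathsf{AGP}_{\mathcal Y}(\mu,\kappa,\theta)$ holds. If $\mathcal Y$ is weakly stationary and $\mathsf{wSP}_{\mathcal Y}(\mu,\kappa,H(\theta))$ holds, then $\mathsf{wAGP}_{\mathcal Y}(\mu,\kappa,\theta)$ holds. (4) Let $\lambda\ge\kappa$ be a cardinal and $\mathcal Y\subseteq\mathscr P_\kappa\lambda$. If $\mathcal Y$ is stationary and there is a regular cardinal $\theta>\lambda^{<\kappa}$ such that $\mathsf{AGP}_{\mathcal Y'}(\mu,\kappa,\theta)$ holds for $\mathcal Y'=\mathcal Y\uparrow\mathscr P_\kappa H(\theta)$, then $\mathsf{SP}_{\mathcal Y}(\mu,\kappa,\lambda)$ holds. If $\mathcal Y$ is weakly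 stationary and there is a regular cardinal $\theta>\lambda^{<\kappa}$ such that $\mathsf{wAGP}_{\mathcal Y'}(\mu,\kappa,\theta)$ holds for $\mathcal Y'=\mathcal Y\uparrow\mathscr P_\kappa H(\theta)$, then $\mathsf{wSP}_{\mathcal Y}(\mu,\kappa,\lambda)$ holds. -/

import Mathlib

open Cardinal

universe u

/-! Everything takes place in the universe `ZFSet.{u}` of sets. A family of subsets of a set `X`
is a `Set ZFSet` all of whose members lie in `P_κ X`; a cardinal `lam` is identified as a set with
its initial von Neumann ordinal. -/

namespace TwoCardinal

noncomputable section

/-- A cardinal, viewed as a set: the von Neumann ordinal of its initial ordinal. -/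
def cardSet (lam : Cardinal.{u}) : ZFSet.{u} := lam.ord.toZFSet

/-- `P_κ X`, the family of all subsets of `X` of cardinality less than `κ`. -/
def Pk (κ : Cardinal.{u}) (X : ZFSet.{u}) : Set ZFSet.{u} := {x | x ⊆ X ∧ x.card < κ}

/-- `H(θ)`, the set of all `x` whose transitive closure has size less than `θ` (equivalently, `x`
is included in some transitive set of size less than `θ`). Separating from the level `V_θ` of the
cumulative hierarchy is only needed to see that this is a set and loses nothing: see `mem_H`. -/
def H (θ : Cardinal.{u}) : ZFSet.{u} :=
  ZFSet.sep (fun x => ∃ t : ZFSet.{u}, t.IsTransitive ∧ x ⊆ t ∧ t.card < θ)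
    (ZFSet.vonNeumann θ.ord)

theorem exists_rank_eq {t : ZFSet.{u}} (ht : t.IsTransitive) (o : Ordinal.{u}) :
    ∀ z : ZFSet.{u}, z ∈ t → o ≤ z.rank → ∃ y ∈ t, y.rank = o := by
  intro z
  induction z using ZFSet.inductionOn with
  | _ z ih =>
    intro hz ho
    rcases ho.eq_or_lt with h | h
    · exact ⟨z, hz, h.symm⟩
    · obtain ⟨w, hw, how⟩ := ZFSet.lt_rank_iff.1 h
      exact ih w hw (ht.subset_of_mem hz hw) how

theorem card_rank_le {t : ZFSet.{u}} (ht : t.IsTransitive) : t.rank.card ≤ t.card := by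
  have hsub : Set.Iio t.rank ⊆ ZFSet.rank '' (t : Set ZFSet.{u}) := by
    intro o ho
    obtain ⟨z, hz, hoz⟩ := ZFSet.lt_rank_iff.1 (Set.mem_Iio.1 ho)
    obtain ⟨y, hy, rfl⟩ := exists_rank_eq ht o z hz hoz
    exact ⟨y, hy, rfl⟩
  have h := (Cardinal.mk_le_mk_of_subset hsub).trans Cardinal.mk_image_le
  rw [Cardinal.mk_Iio_ordinal] at h
  have h2 : #(t : Set ZFSet.{u}) = Cardinal.lift.{u + 1, u} t.card := ZFSet.cardinalMk_coe_sort
  rw [h2, Cardinal.lift_le] at h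
  exact h

/-- Membership in `H(θ)` is exactly the usual condition. -/
theorem mem_H {θ : Cardinal.{u}} {x : ZFSet.{u}} :
    x ∈ H θ ↔ ∃ t : ZFSet.{u}, t.IsTransitive ∧ x ⊆ t ∧ t.card < θ := by
  rw [H, ZFSet.mem_sep]
  refine ⟨fun h => h.2, fun h => ⟨?_, h⟩⟩
  obtain ⟨t, ht, hxt, hc⟩ := h
  rw [ZFSet.mem_vonNeumann]
  refine (ZFSet.rank_mono hxt).trans_lt ?_
  rw [Cardinal.lt_ord]
  exact (card_rank_le ht).trans_lt hc

/-! ### Clubs, strong clubs, stationary and weakly stationary families -/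

/-- `C` is a cofinal subfamily of `P_κ X`. -/
def IsCofinalFamily (κ : Cardinal.{u}) (X : ZFSet.{u}) (C : Set ZFSet.{u}) : Prop :=
  C ⊆ Pk κ X ∧ ∀ x ∈ Pk κ X, ∃ y ∈ C, x ⊆ y

/-- `C` is closed under unions of nonempty `⊆`-chains of length less than `κ`. -/
def IsClosedFamily (κ : Cardinal.{u}) (C : Set ZFSet.{u}) : Prop :=
  ∀ D : ZFSet.{u}, D.Nonempty → (∀ x ∈ D, x ∈ C) → D.card < κ →
    (∀ x ∈ D, ∀ y ∈ D, x ⊆ y ∨ y ⊆ x) → (ZFSet.sUnion D) ∈ C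

/-- `C` is closed under unions of nonempty subfamilies of size less than `κ`. -/
def IsStronglyClosedFamily (κ : Cardinal.{u}) (C : Set ZFSet.{u}) : Prop :=
  ∀ D : ZFSet.{u}, D.Nonempty → (∀ x ∈ D, x ∈ C) → D.card < κ → (ZFSet.sUnion D) ∈ C

/-- `C` is a club in `P_κ X`. -/
def IsClubFamily (κ : Cardinal.{u}) (X : ZFSet.{u}) (C : Set ZFSet.{u}) : Prop :=
  IsCofinalFamily κ X C ∧ IsClosedFamily κ C

/-- `C` is a strong club in `P_κ X`. -/
def IsStrongClubFamily (κ : Cardinal.{u}) (X : ZFSet.{u}) (C : Set ZFSet.{u}) : Prop :=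
  IsCofinalFamily κ X C ∧ IsStronglyClosedFamily κ C

/-- `S` is a stationary subset of `P_κ X`. -/
def IsStationaryFamily (κ : Cardinal.{u}) (X : ZFSet.{u}) (S : Set ZFSet.{u}) : Prop :=
  S ⊆ Pk κ X ∧ ∀ C, IsClubFamily κ X C → (C ∩ S).Nonempty

/-- `S` is a weakly stationary subset of `P_κ X`. -/
def IsWeaklyStationaryFamily (κ : Cardinal.{u}) (X : ZFSet.{u}) (S : Set ZFSet.{u}) : Prop :=
  S ⊆ Pk κ X ∧ ∀ C, IsStrongClubFamily κ X C → (C ∩ S).Nonempty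

/-- For `X ⊆ X'` and `S ⊆ P_κ X`, the lift `S ↑ P_κ X'`. -/
def familyLift (κ : Cardinal.{u}) (X X' : ZFSet.{u}) (S : Set ZFSet.{u}) : Set ZFSet.{u} :=
  {y | y ∈ Pk κ X' ∧ y ∩ X ∈ S}

/-! ### Lists and the slender tree properties -/

/-- `D` is a `(κ, X)`-list; only its values on `P_κ X` matter. -/
def IsList (κ : Cardinal.{u}) (X : ZFSet.{u}) (D : ZFSet.{u} → ZFSet.{u}) : Prop :=
  ∀ x ∈ Pk κ X, D x ⊆ x

/-- `d` is a cofinal branch of the `(κ, X)`-list `D`. -/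
def IsCofinalBranch (κ : Cardinal.{u}) (X : ZFSet.{u}) (D : ZFSet.{u} → ZFSet.{u})
    (d : ZFSet.{u}) : Prop :=
  d ⊆ X ∧ ∀ x ∈ Pk κ X, ∃ z ∈ Pk κ X, x ⊆ z ∧ d ∩ x = D z ∩ x

/-- The list `D` is `μ`-`Y`-slender. -/
def Slender (μ κ : Cardinal.{u}) (X : ZFSet.{u}) (Y : Set ZFSet.{u})
    (D : ZFSet.{u} → ZFSet.{u}) : Prop :=
  ∃ θ₀ : Cardinal.{u}, ∀ θ : Cardinal.{u}, θ₀ ≤ θ → ∃ C, IsClubFamily κ (H θ) C ∧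
    ∀ M ∈ C, ∀ y ∈ M, y ∈ Pk μ X → M ∩ X ∈ Y → D (M ∩ X) ∩ y ∈ M

/-- The list `D` is strongly `μ`-`Y`-slender. -/
def StronglySlender (μ κ : Cardinal.{u}) (X : ZFSet.{u}) (Y : Set ZFSet.{u})
    (D : ZFSet.{u} → ZFSet.{u}) : Prop :=
  ∃ θ₀ : Cardinal.{u}, ∀ θ : Cardinal.{u}, θ₀ ≤ θ → θ.IsRegular → ∃ C, IsStrongClubFamily κ (H θ) C ∧
    ∀ M ∈ C, ∀ y ∈ M, y ∈ Pk μ X → M ∩ X ∈ Y → ∃ e ∈ M, D (M ∩ X) ∩ y = e ∩ y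

/-- The slender tree property `SP_Y(μ, κ, X)`. -/
def SP (Y : Set ZFSet.{u}) (μ κ : Cardinal.{u}) (X : ZFSet.{u}) : Prop :=
  ∀ D, IsList κ X D → Slender μ κ X Y D → ∃ d, IsCofinalBranch κ X D d

/-- The weak slender tree property `wSP_Y(μ, κ, X)`. -/
def WSP (Y : Set ZFSet.{u}) (μ κ : Cardinal.{u}) (X : ZFSet.{u}) : Prop :=
  ∀ D, IsList κ X D → StronglySlender μ κ X Y D → ∃ d, IsCofinalBranch κ X D d

/-! ### Almost guessing -/

/-- The subset `d` of `x` is `(μ, M)`-approximated. -/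
def Approximated (μ : Cardinal.{u}) (M x d : ZFSet.{u}) : Prop :=
  ∀ z ∈ M, z ∈ Pk μ x → ∃ e ∈ M, d ∩ z = e ∩ z

/-- `d` is `N`-guessed. -/
def Guessed (N d : ZFSet.{u}) : Prop := ∃ e ∈ N, d ∩ N = e ∩ N

/-- `(M, x)` is almost `μ`-guessed by `S`. -/
def AlmostGuessed (μ : Cardinal.{u}) (S : Set ZFSet.{u}) (M x : ZFSet.{u}) : Prop :=
  x ∈ M ∧ ∀ d, d ⊆ x → Approximated μ M x d → ∃ N ∈ S, x ∈ N ∧ N ⊆ M ∧ Guessed N d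

/-- The almost guessing property `AGP_Y(μ, κ, θ)`. -/
def AGP (Y : Set ZFSet.{u}) (μ κ θ : Cardinal.{u}) : Prop :=
  ∀ S, IsCofinalFamily κ (H θ) S → ∀ x ∈ H θ,
    IsStationaryFamily κ (H θ) {M | M ∈ Pk κ (H θ) ∧ M ∈ Y ∧ AlmostGuessed μ S M x}

/-- The weak almost guessing property `wAGP_Y(μ, κ, θ)`. -/
def WAGP (Y : Set ZFSet.{u}) (μ κ θ : Cardinal.{u}) : Prop :=
  ∀ S, IsCofinalFamily κ (H θ) S → ∀ x ∈ H θ,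
    IsWeaklyStationaryFamily κ (H θ) {M | M ∈ Pk κ (H θ) ∧ M ∈ Y ∧ AlmostGuessed μ S M x}

end

end TwoCardinal

open TwoCardinal

namespace TwoCardinal

/-! ### Cardinality bounds -/

/-! From trees to guessing (`agpOfKind_of_spOfKind`): if almost guessing of `x` fails for a cofinal
`S` on a club, every `M` of `Y` in that club carries an approximated `d_M ⊆ x` that no `N ∈ S` with
`x ∈ N ⊆ M` guesses. These sets, restricted to smaller indices where needed, form a slender list. A
cofinal branch `b` is a subset of `x`, hence an element of `H(θ)`, so some `N ∈ S` contains `x` and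
`b`. Agreement of `b` with the list on `N` then says that `b` guesses some `d_M` on `N ⊆ M`, a
contradiction.

From guessing to trees (`spOfKind_of_agpOfKind`): if a slender list has no branch, every `d ⊆ X` has
a small set `x d` on which it disagrees with all later list entries. Let `S` consist of the `N`
closed under `e ↦ x (e ∩ X)`. Slenderness makes the entry at `M ∩ X` approximated for club many `M`.
Almost guessing yields `N ∈ S` below such an `M` and `c ∈ N` agreeing with that entry on `N ⊇ x (c ∩
X)`, a contradiction.

Both versions are proved at once, with a proposition `s` selecting strong clubs. Clubs are generated
by functions of finitely many arguments, strong clubs by functions of at most one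
(`IsClubOfKind.exists_closedUnder_subset`); this gives intersections and projections of clubs.
Passing between `H(θ)` and cardinals in the global equivalence uses invariance under bijections
(`spOfKind_of_card_eq`). -/

theorem card_sUnion_lt {κ : Cardinal.{u}} (hκ : κ.IsRegular) {D : ZFSet.{u}} (hD : D.card < κ)
    (h : ∀ x ∈ D, x.card < κ) : (ZFSet.sUnion D).card < κ := by
  have e : ZFSet.sUnion D =
      ZFSet.iUnion fun i : Shrink.{u} D => (((equivShrink D).symm i : D) : ZFSet.{u}) := by
    ext z
    simp only [ZFSet.mem_sUnion, ZFSet.mem_iUnion]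
    constructor
    · rintro ⟨y, hy, hz⟩
      exact ⟨equivShrink D ⟨y, hy⟩, by simpa using hz⟩
    · rintro ⟨i, hi⟩
      exact ⟨_, ((equivShrink D).symm i).2, hi⟩
  have := ZFSet.lift_card_iUnion_le_sum_card.{u, u}
    (f := fun i : Shrink.{u} D => (((equivShrink D).symm i : D) : ZFSet.{u}))
  rw [e]
  rw [Cardinal.lift_id] at this
  exact this.trans_lt (Cardinal.sum_lt_of_isRegular hκ hD fun i => h _ ((equivShrink D).symm i).2)

theorem card_union_lt {κ : Cardinal.{u}} (hκ : ℵ₀ ≤ κ) {x y : ZFSet.{u}} (hx : x.card < κ)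
    (hy : y.card < κ) : (x ∪ y).card < κ :=
  ZFSet.card_union_le.trans_lt (Cardinal.add_lt_of_lt hκ hx hy)

theorem card_range_lt {κ : Cardinal.{u}} {α : Type*} [Small.{u} α] {f : α → ZFSet.{u}}
    (h : #(Shrink.{u} α) < κ) : (ZFSet.range f).card < κ := by
  have := ZFSet.lift_card_range_le (f := fun i : Shrink.{u} α => f ((equivShrink α).symm i))
  rw [Cardinal.lift_id, Cardinal.lift_id] at this
  have e : ZFSet.range f = ZFSet.range fun i : Shrink.{u} α => f ((equivShrink α).symm i) := by
    ext z
    rw [ZFSet.mem_range, ZFSet.mem_range]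
    exact ⟨fun ⟨i, hi⟩ => ⟨equivShrink α i, by simpa using hi⟩, fun ⟨i, hi⟩ => ⟨_, hi⟩⟩
  rw [e]
  exact this.trans_lt h

theorem card_singleton_lt {κ : Cardinal.{u}} (hκ : ℵ₀ ≤ κ) (x : ZFSet.{u}) :
    ({x} : ZFSet.{u}).card < κ := by
  rw [ZFSet.card_singleton]; exact Cardinal.one_lt_aleph0.trans_le hκ

/-! ### Finite subsets of a set -/

/-- `a` is a finite subset of `M`, with at most one element if `s` holds. -/
def IsFinSub (s : Prop) (a : Finset ZFSet.{u}) (M : ZFSet.{u}) : Prop :=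
  (∀ z ∈ a, z ∈ M) ∧ (s → a.card ≤ 1)

theorem IsFinSub.mono {s : Prop} {a : Finset ZFSet.{u}} {M N : ZFSet.{u}} (h : IsFinSub s a M)
    (hMN : M ⊆ N) : IsFinSub s a N :=
  ⟨fun z hz => hMN (h.1 z hz), h.2⟩

theorem isFinSub_empty (s : Prop) (M : ZFSet.{u}) : IsFinSub s ∅ M :=
  ⟨fun z hz => absurd hz (Finset.notMem_empty z), fun _ => by simp⟩

theorem isFinSub_singleton (s : Prop) {z M : ZFSet.{u}} (hz : z ∈ M) : IsFinSub s {z} M :=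
  ⟨fun y hy => by rwa [Finset.mem_singleton.1 hy], fun _ => by simp⟩

/-- Pulling finite subsets of `M` back to a type in universe `u` makes their collection small and
lets it be counted. -/
theorem exists_finset_map {s : Prop} {a : Finset ZFSet.{u}} {M : ZFSet.{u}}
    (h : IsFinSub s a M) : ∃ b : Finset (Shrink.{u} M),
      b.map ⟨fun i => (((equivShrink M).symm i : M) : ZFSet.{u}),
        Subtype.val_injective.comp (equivShrink M).symm.injective⟩ = a := by
  classical
  refine ⟨a.attach.image fun z : {z // z ∈ a} => equivShrink M ⟨z.1, h.1 z.1 z.2⟩, ?_⟩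
  ext z
  simp only [Finset.mem_map, Finset.mem_image, Finset.mem_attach, true_and,
    Function.Embedding.coeFn_mk]
  constructor
  · rintro ⟨_, ⟨y, rfl⟩, rfl⟩
    simp
  · intro hz
    exact ⟨_, ⟨⟨z, hz⟩, rfl⟩, by simp⟩

theorem finSub_injective (s : Prop) (M : ZFSet.{u}) : Function.Injective
    fun a : {a : Finset ZFSet.{u} // IsFinSub s a M} => (exists_finset_map a.2).choose := by
  intro a b hab
  apply Subtype.ext
  rw [← (exists_finset_map a.2).choose_spec, ← (exists_finset_map b.2).choose_spec]
  exact congrArg _ hab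

instance small_finSub (s : Prop) (M : ZFSet.{u}) :
    Small.{u} {a : Finset ZFSet.{u} // IsFinSub s a M} :=
  small_of_injective (finSub_injective s M)

theorem mk_finset_lt {κ : Cardinal.{u}} (hκ : ℵ₀ ≤ κ) {α : Type u} (h : #α < κ) :
    #(Finset α) < κ := by
  cases finite_or_infinite α
  · exact (Cardinal.lt_aleph0_of_finite _).trans_le hκ
  · rwa [Cardinal.mk_finset_of_infinite]

/-- The family of all values of `g` at finite subsets of `M`. -/
noncomputable def finImage (s : Prop) (g : Finset ZFSet.{u} → ZFSet.{u}) (M : ZFSet.{u}) :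
    ZFSet.{u} :=
  ZFSet.range fun a : {a : Finset ZFSet.{u} // IsFinSub s a M} => g a

theorem mem_finImage {s : Prop} {g : Finset ZFSet.{u} → ZFSet.{u}} {M z : ZFSet.{u}} :
    z ∈ finImage s g M ↔ ∃ a, IsFinSub s a M ∧ g a = z := by
  simp [finImage]

theorem card_finImage_lt {κ : Cardinal.{u}} (hκ : ℵ₀ ≤ κ) {s : Prop}
    {g : Finset ZFSet.{u} → ZFSet.{u}} {M : ZFSet.{u}} (hM : M.card < κ) :
    (finImage s g M).card < κ := by
  refine card_range_lt (lt_of_le_of_lt ?_ (mk_finset_lt hκ hM))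
  exact Cardinal.mk_le_of_injective ((finSub_injective s M).comp (equivShrink _).symm.injective)

/-- A finite subset of the union of a directed family is included in a member of the family. For
subsets with at most one element, directedness is not needed. -/
theorem IsFinSub.exists_of_directed {s : Prop} {a : Finset ZFSet.{u}} {D : Set ZFSet.{u}}
    (hD : D.Nonempty) (hdir : ¬ s → DirectedOn (· ⊆ ·) D)
    (h : ∀ z ∈ a, ∃ N ∈ D, z ∈ N) (hs : s → a.card ≤ 1) : ∃ N ∈ D, IsFinSub s a N := by
  classical
  by_cases hs' : s
  · rcases Finset.card_le_one_iff_subset_singleton.1 (hs hs') with ⟨z, hz⟩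
    rcases Finset.subset_singleton_iff.1 hz with rfl | rfl
    · obtain ⟨N, hN⟩ := hD
      exact ⟨N, hN, isFinSub_empty _ _⟩
    · obtain ⟨N, hN, hz⟩ := h z (Finset.mem_singleton_self z)
      exact ⟨N, hN, isFinSub_singleton _ hz⟩
  · replace hdir := hdir hs'
    suffices ∃ N ∈ D, ∀ z ∈ a, z ∈ N by
      obtain ⟨N, hN, ha⟩ := this
      exact ⟨N, hN, ha, hs⟩
    clear hs
    induction a using Finset.induction_on with
    | empty =>
      obtain ⟨N, hN⟩ := hD
      exact ⟨N, hN, by simp⟩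
    | insert y a _ ih =>
      obtain ⟨N, hN, ha⟩ := ih fun z hz => h z (Finset.mem_insert_of_mem hz)
      obtain ⟨N', hN', hy⟩ := h y (Finset.mem_insert_self _ _)
      obtain ⟨P, hP, h1, h2⟩ := hdir N hN N' hN'
      refine ⟨P, hP, fun z hz => ?_⟩
      rcases Finset.mem_insert.1 hz with rfl | hz
      · exact h2 hy
      · exact h1 (ha z hz)

/-! ### Clubs and strong clubs, treated uniformly -/

/-- `C` is a strong club in `P_κ X` if `s` holds, and a club in `P_κ X` otherwise. -/
def IsClubOfKind (s : Prop) (κ : Cardinal.{u}) (X : ZFSet.{u}) (C : Set ZFSet.{u}) : Prop :=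
  IsCofinalFamily κ X C ∧ ∀ D : ZFSet.{u}, D.Nonempty → (∀ x ∈ D, x ∈ C) → D.card < κ →
    (¬ s → ∀ x ∈ D, ∀ y ∈ D, x ⊆ y ∨ y ⊆ x) → (ZFSet.sUnion D) ∈ C

theorem isClubOfKind_false {κ : Cardinal.{u}} {X : ZFSet.{u}} {C : Set ZFSet.{u}} :
    IsClubOfKind False κ X C ↔ IsClubFamily κ X C := by
  simp [IsClubOfKind, IsClubFamily, IsClosedFamily]

theorem isClubOfKind_true {κ : Cardinal.{u}} {X : ZFSet.{u}} {C : Set ZFSet.{u}} :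
    IsClubOfKind True κ X C ↔ IsStrongClubFamily κ X C := by
  simp [IsClubOfKind, IsStrongClubFamily, IsStronglyClosedFamily]

/-- `M` is closed under the set-valued function `g` of finitely many arguments (of at most one
argument if `s` holds). -/
def ClosedUnder (s : Prop) (g : Finset ZFSet.{u} → ZFSet.{u}) (M : ZFSet.{u}) : Prop :=
  ∀ a, IsFinSub s a M → g a ⊆ M

theorem sUnion_mem_Pk {κ : Cardinal.{u}} (hκ : κ.IsRegular) {X D : ZFSet.{u}} (hD : D.card < κ)
    (h : ∀ x ∈ D, x ∈ Pk κ X) : ZFSet.sUnion D ∈ Pk κ X := by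
  refine ⟨fun z hz => ?_, card_sUnion_lt hκ hD fun x hx => (h x hx).2⟩
  obtain ⟨x, hx, hz⟩ := ZFSet.mem_sUnion.1 hz
  exact (h x hx).1 hz

theorem union_mem_Pk {κ : Cardinal.{u}} (hκ : ℵ₀ ≤ κ) {X x y : ZFSet.{u}} (hx : x ∈ Pk κ X)
    (hy : y ∈ Pk κ X) : x ∪ y ∈ Pk κ X := by
  refine ⟨fun z hz => ?_, card_union_lt hκ hx.2 hy.2⟩
  rcases ZFSet.mem_union.1 hz with h | h
  exacts [hx.1 h, hy.1 h]

theorem singleton_mem_Pk {κ : Cardinal.{u}} (hκ : ℵ₀ ≤ κ) {X z : ZFSet.{u}} (hz : z ∈ X) :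
    {z} ∈ Pk κ X :=
  ⟨fun y hy => by rwa [ZFSet.mem_singleton.1 hy], card_singleton_lt hκ z⟩

theorem Pk_mono {μ κ : Cardinal.{u}} (h : μ ≤ κ) {X X' : ZFSet.{u}} (hX : X ⊆ X') :
    Pk μ X ⊆ Pk κ X' :=
  fun _ hx => ⟨fun _ hz => hX (hx.1 hz), hx.2.trans_le h⟩

theorem inter_mem_Pk {κ : Cardinal.{u}} {X M : ZFSet.{u}} (hM : M.card < κ) : M ∩ X ∈ Pk κ X :=
  ⟨fun _ hz => (ZFSet.mem_inter.1 hz).2,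
    (ZFSet.card_mono fun _ hz => (ZFSet.mem_inter.1 hz).1).trans_lt hM⟩

theorem empty_mem_Pk {κ : Cardinal.{u}} (hκ : ℵ₀ ≤ κ) (X : ZFSet.{u}) : ∅ ∈ Pk κ X :=
  ⟨ZFSet.empty_subset X, by rw [ZFSet.card_empty]; exact Cardinal.aleph0_pos.trans_le hκ⟩

/-- Add all values of `g` and repeat `ω` times. Regularity keeps each stage below `κ`,
uncountability keeps the union below `κ`, and a finite subset of the union already appears at a
finite stage. -/
theorem exists_closedUnder {s : Prop} {κ : Cardinal.{u}} (hκ : κ.IsRegular) (hκ' : ℵ₀ < κ)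
    {X : ZFSet.{u}} {g : Finset ZFSet.{u} → ZFSet.{u}} (hg : ∀ a, g a ∈ Pk κ X) {x : ZFSet.{u}}
    (hx : x ∈ Pk κ X) : ∃ M ∈ Pk κ X, x ⊆ M ∧ ClosedUnder s g M := by
  let A : ℕ → ZFSet.{u} := fun n =>
    Nat.rec x (fun _ y => y ∪ ZFSet.sUnion (finImage s g y)) n
  have hA : ∀ n, A (n + 1) = A n ∪ ZFSet.sUnion (finImage s g (A n)) := fun _ => rfl
  have hAP : ∀ n, A n ∈ Pk κ X := by
    intro n
    induction n with
    | zero => exact hx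
    | succ n ih =>
      rw [hA]
      refine union_mem_Pk hκ'.le ih (sUnion_mem_Pk hκ (card_finImage_lt hκ'.le ih.2) ?_)
      intro y hy
      obtain ⟨a, -, rfl⟩ := mem_finImage.1 hy
      exact hg a
  have hmono : ∀ m n, m ≤ n → A m ⊆ A n := by
    intro m n hmn
    induction n, hmn using Nat.le_induction with
    | base => exact fun _ h => h
    | succ n _ ih => rw [hA]; exact fun z hz => ZFSet.mem_union.2 (.inl (ih hz))
  refine ⟨ZFSet.sUnion (ZFSet.range A), sUnion_mem_Pk hκ (card_range_lt ?_) ?_, ?_, ?_⟩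
  · refine lt_of_le_of_lt ?_ hκ'
    exact Cardinal.mk_le_aleph0
  · intro y hy
    obtain ⟨n, rfl⟩ := ZFSet.mem_range.1 hy
    exact hAP n
  · exact fun z hz => ZFSet.mem_sUnion.2 ⟨A 0, ZFSet.mem_range.2 ⟨0, rfl⟩, hz⟩
  · intro a ha
    obtain ⟨N, ⟨n, rfl⟩, hN⟩ := IsFinSub.exists_of_directed (s := s) (a := a) (D := Set.range A)
      ⟨_, 0, rfl⟩ (fun _ => by
        rintro _ ⟨m, rfl⟩ _ ⟨n, rfl⟩
        exact ⟨_, ⟨max m n, rfl⟩, hmono _ _ (le_max_left _ _), hmono _ _ (le_max_right _ _)⟩)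
      (fun z hz => by simpa using ha.1 z hz) ha.2
    intro z hz
    refine ZFSet.mem_sUnion.2 ⟨A (n + 1), ZFSet.mem_range.2 ⟨n + 1, rfl⟩, ?_⟩
    rw [hA]
    exact ZFSet.mem_union.2 (.inr (ZFSet.mem_sUnion.2 ⟨_, mem_finImage.2 ⟨a, hN, rfl⟩, hz⟩))

theorem isClubOfKind_closedUnder (s : Prop) {κ : Cardinal.{u}} (hκ : κ.IsRegular) (hκ' : ℵ₀ < κ)
    {X : ZFSet.{u}} {g : Finset ZFSet.{u} → ZFSet.{u}} (hg : ∀ a, g a ∈ Pk κ X) :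
    IsClubOfKind s κ X {M | M ∈ Pk κ X ∧ ClosedUnder s g M} := by
  refine ⟨⟨fun M hM => hM.1, fun x hx => ?_⟩, fun D hD hDC hcard hch => ?_⟩
  · obtain ⟨M, hM, hxM, hcl⟩ := exists_closedUnder (s := s) hκ hκ' hg hx
    exact ⟨M, ⟨hM, hcl⟩, hxM⟩
  · refine ⟨sUnion_mem_Pk hκ hcard fun x hx => (hDC x hx).1, fun a ha z hz => ?_⟩
    obtain ⟨N, hN, haN⟩ := IsFinSub.exists_of_directed (s := s) (a := a) (D := (D : Set ZFSet.{u}))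
      hD (fun hs x hx y hy => by
        rcases hch hs x hx y hy with h | h
        · exact ⟨y, hy, h, fun _ h => h⟩
        · exact ⟨x, hx, fun _ h => h, h⟩)
      (fun z hz => by simpa using ha.1 z hz) ha.2
    exact ZFSet.mem_sUnion.2 ⟨N, hN, (hDC N hN).2 a haN hz⟩

/-! ### Clubs contain the families of closed sets of finitary functions -/

theorem card_sep_finset_lt {κ : Cardinal.{u}} (hκ : ℵ₀ ≤ κ) (X : ZFSet.{u})
    (a : Finset ZFSet.{u}) : (ZFSet.sep (· ∈ a) X).card < κ := by
  refine lt_of_lt_of_le ?_ hκ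
  have : Finite (Shrink.{u} (ZFSet.sep (· ∈ a) X)) := by
    refine Finite.of_injective (β := a)
      (fun i => ⟨((equivShrink _).symm i).1, (ZFSet.mem_sep.1 ((equivShrink _).symm i).2).2⟩) ?_
    intro i j hij
    exact (equivShrink _).symm.injective (Subtype.ext (congrArg (fun z : a => z.1) hij))
  exact Cardinal.lt_aleph0_of_finite _

theorem finImage_mono {s : Prop} {g : Finset ZFSet.{u} → ZFSet.{u}} {M N : ZFSet.{u}}
    (h : M ⊆ N) : ZFSet.sUnion (finImage s g M) ⊆ ZFSet.sUnion (finImage s g N) := by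
  intro z hz
  obtain ⟨y, hy, hz⟩ := ZFSet.mem_sUnion.1 hz
  obtain ⟨a, ha, rfl⟩ := mem_finImage.1 hy
  exact ZFSet.mem_sUnion.2 ⟨_, mem_finImage.2 ⟨a, ha.mono h, rfl⟩, hz⟩

/-- A family closed under unions of short chains is closed under unions of short directed systems
indexed by the finite subsets of a set. -/
theorem sUnion_finImage_mem {κ : Cardinal.{u}} {C : Set ZFSet.{u}}
    (hC : ∀ D : ZFSet.{u}, D.Nonempty → (∀ x ∈ D, x ∈ C) → D.card < κ →
      (∀ x ∈ D, ∀ y ∈ D, x ⊆ y ∨ y ⊆ x) → (ZFSet.sUnion D) ∈ C)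
    {g : Finset ZFSet.{u} → ZFSet.{u}} (hgC : ∀ a, g a ∈ C) (hmono : ∀ a b, a ⊆ b → g a ⊆ g b)
    (B : ZFSet.{u}) (hB : B.card < κ) : ZFSet.sUnion (finImage False g B) ∈ C := by
  induction hc : B.card using WellFoundedLT.induction generalizing B with
  | ind c ih =>
  subst hc
  rcases lt_or_ge B.card ℵ₀ with hfin | hinf
  · have : Finite B := by
      have : Finite (Shrink.{u} B) := Cardinal.lt_aleph0_iff_finite.1 hfin
      exact Finite.of_equiv _ (equivShrink B).symm
    have hf : (B : Set ZFSet.{u}).Finite := this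
    -- For finite `B` the directed system has a largest member, the value at `B` itself.
    have e : ZFSet.sUnion (finImage False g B) = g hf.toFinset := by
      ext z
      rw [ZFSet.mem_sUnion]
      constructor
      · rintro ⟨y, hy, hz⟩
        obtain ⟨a, ha, rfl⟩ := mem_finImage.1 hy
        exact hmono _ _ (fun w hw => by simpa using ha.1 w hw) hz
      · exact fun hz => ⟨_, mem_finImage.2 ⟨_, ⟨fun w hw => by simpa using hw, False.elim⟩, rfl⟩, hz⟩
    rw [e]
    exact hgC _
  -- Enumerate `B` in order type its cardinal. Proper initial segments are smaller, so induction
  -- applies to them, and their unions form a chain. Since there is no last index, every finite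
  -- subset of `B` lies in some segment.
  · have := Cardinal.noMaxOrder hinf
    have hne : Nonempty B.card.ord.ToType := by
      rw [← Cardinal.mk_ne_zero_iff, Cardinal.mk_ord_toType]
      exact (Cardinal.aleph0_pos.trans_le hinf).ne'
    obtain ⟨e⟩ : Nonempty (B ≃ B.card.ord.ToType) :=
      ⟨(equivShrink.{u} B).trans (Cardinal.eq.1 (Cardinal.mk_ord_toType B.card).symm).some⟩
    let I : B.card.ord.ToType → ZFSet.{u} := fun i => ZFSet.sep (fun z => ∃ hz : z ∈ B, e ⟨z, hz⟩ < i) B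
    have hI : ∀ i z, z ∈ I i ↔ ∃ hz : z ∈ B, e ⟨z, hz⟩ < i := fun i z => by
      simp only [I, ZFSet.mem_sep]
      exact ⟨fun h => h.2, fun h => ⟨h.1, h⟩⟩
    have hIB : ∀ i, I i ⊆ B := fun i z hz => ((hI i z).1 hz).1
    have hImono : ∀ i j, i ≤ j → I i ⊆ I j := fun i j hij z hz => by
      obtain ⟨h1, h2⟩ := (hI i z).1 hz
      exact (hI j z).2 ⟨h1, h2.trans_le hij⟩
    have hIcard : ∀ i, (I i).card < B.card := by
      intro i
      refine lt_of_le_of_lt ?_ ((Cardinal.mk_Iio_lt i (by simp)).trans_eq (Cardinal.mk_ord_toType _))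
      refine Cardinal.mk_le_of_injective (f := fun w => (⟨e ⟨((equivShrink (I i)).symm w).1,
        hIB i ((equivShrink (I i)).symm w).2⟩, ((hI i _).1 ((equivShrink (I i)).symm w).2).2⟩ :
          Set.Iio i)) ?_
      intro w w' h
      have h1 := e.injective (congrArg Subtype.val h)
      exact (equivShrink _).symm.injective (Subtype.ext (congrArg (fun z : B => z.1) h1))
    have key := hC (ZFSet.range fun i => ZFSet.sUnion (finImage False g (I i)))
      (ZFSet.nonempty_of_mem (ZFSet.mem_range_self hne.some)) (by
        intro x hx
        obtain ⟨i, rfl⟩ := ZFSet.mem_range.1 hx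
        exact ih _ (hIcard i) _ ((hIcard i).trans hB) rfl)
      (card_range_lt (by
        rw [Cardinal.mk_congr (equivShrink.{u} B.card.ord.ToType).symm, Cardinal.mk_ord_toType]
        exact hB)) (by
        intro x hx y hy
        obtain ⟨i, rfl⟩ := ZFSet.mem_range.1 hx
        obtain ⟨j, rfl⟩ := ZFSet.mem_range.1 hy
        rcases le_total i j with h | h
        · exact .inl (finImage_mono (hImono _ _ h))
        · exact .inr (finImage_mono (hImono _ _ h)))
    convert key using 1
    ext z
    rw [ZFSet.mem_sUnion, ZFSet.mem_sUnion]
    constructor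
    · rintro ⟨y, hy, hz⟩
      obtain ⟨a, ha, rfl⟩ := mem_finImage.1 hy
      obtain ⟨_, ⟨i, rfl⟩, hi⟩ := IsFinSub.exists_of_directed (s := False) (a := a)
        (D := Set.range I) ⟨_, hne.some, rfl⟩ (fun _ => by
          rintro _ ⟨i, rfl⟩ _ ⟨j, rfl⟩
          exact ⟨_, ⟨max i j, rfl⟩, hImono _ _ (le_max_left _ _), hImono _ _ (le_max_right _ _)⟩)
        (fun w hw => by
          obtain ⟨j, hj⟩ := exists_gt (e ⟨w, ha.1 w hw⟩)
          exact ⟨_, ⟨j, rfl⟩, (hI j w).2 ⟨ha.1 w hw, hj⟩⟩) False.elim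
      exact ⟨_, ZFSet.mem_range_self i, ZFSet.mem_sUnion.2 ⟨_, mem_finImage.2 ⟨a, hi, rfl⟩, hz⟩⟩
    · rintro ⟨y, hy, hz⟩
      obtain ⟨i, rfl⟩ := ZFSet.mem_range.1 hy
      exact ZFSet.mem_sUnion.1 (finImage_mono (hIB i) hz)

-- By recursion along proper inclusion, `g a` is chosen in `C` above both `a ∩ X` and every `g b`
-- with `b ⊂ a`; there are only finitely many such `b`, so their union is still small.
open Classical in
theorem exists_monotone_finset_function {κ : Cardinal.{u}} (hκ : κ.IsRegular) {X : ZFSet.{u}}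
    {C : Set ZFSet.{u}} (hC : IsCofinalFamily κ X C) : ∃ g : Finset ZFSet.{u} → ZFSet.{u},
      (∀ a, g a ∈ C) ∧ (∀ a, ∀ z ∈ a, z ∈ X → z ∈ g a) ∧ ∀ a b, a ⊆ b → g a ⊆ g b := by
  obtain ⟨y₀, hy₀, -⟩ := hC.2 ∅ (empty_mem_Pk hκ.aleph0_le X)
  choose! c hcC hc using hC.2
  let g : Finset ZFSet.{u} → ZFSet.{u} := fun a => Finset.strongInduction (p := fun _ => ZFSet.{u})
    (fun a ih => c (ZFSet.sep (· ∈ a) X ∪ ZFSet.sUnion (ZFSet.range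
      fun b : {b // b ∈ a.ssubsets} => ih b.1 (Finset.mem_ssubsets.1 b.2)))) a
  have hg : ∀ a, g a = c (ZFSet.sep (· ∈ a) X ∪ ZFSet.sUnion (ZFSet.range
      fun b : {b // b ∈ a.ssubsets} => g b)) := fun a => Finset.strongInduction_eq _ a
  have hP : ∀ a, (∀ b, b ⊂ a → g b ∈ Pk κ X) → ZFSet.sep (· ∈ a) X ∪ ZFSet.sUnion (ZFSet.range
      fun b : {b // b ∈ a.ssubsets} => g b) ∈ Pk κ X := by
    intro a ih
    refine union_mem_Pk hκ.aleph0_le ⟨ZFSet.sep_subset, card_sep_finset_lt hκ.aleph0_le X a⟩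
      (sUnion_mem_Pk hκ (card_range_lt ?_) ?_)
    · exact (Cardinal.lt_aleph0_of_finite _).trans_le hκ.aleph0_le
    · intro y hy
      obtain ⟨b, rfl⟩ := ZFSet.mem_range.1 hy
      exact ih b (Finset.mem_ssubsets.1 b.2)
  have hgP : ∀ a, g a ∈ Pk κ X := by
    intro a
    induction a using Finset.strongInduction with
    | H a ih => rw [hg]; exact hC.1 (hcC _ (hP a ih))
  have hsub := fun a => hc _ (hP a fun b _ => hgP b)
  refine ⟨g, fun a => ?_, fun a z hz hX => ?_, fun a b hab => ?_⟩
  · rw [hg]; exact hcC _ (hP a fun b _ => hgP b)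
  · rw [hg]; exact hsub a (ZFSet.mem_union.2 (.inl (ZFSet.mem_sep.2 ⟨hX, hz⟩)))
  · rcases hab.eq_or_ssubset with rfl | h
    · exact fun _ h => h
    · intro z hz
      rw [hg b]
      exact hsub b (ZFSet.mem_union.2 (.inr (ZFSet.mem_sUnion.2
        ⟨g a, ZFSet.mem_range.2 ⟨⟨a, Finset.mem_ssubsets.2 h⟩, rfl⟩, hz⟩)))

/-- A closed `M` is the union of the `g a` for finite `a ⊆ M`, a directed system in `C`. For strong
clubs directedness is irrelevant, and the sets `a` with at most one element suffice. -/
theorem IsClubOfKind.exists_closedUnder_subset {s : Prop} {κ : Cardinal.{u}} (hκ : κ.IsRegular)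
    {X : ZFSet.{u}} {C : Set ZFSet.{u}} (hC : IsClubOfKind s κ X C) :
    ∃ g : Finset ZFSet.{u} → ZFSet.{u}, (∀ a, g a ∈ Pk κ X) ∧
      ∀ M ∈ Pk κ X, ClosedUnder s g M → M ∈ C := by
  obtain ⟨g, hgC, hgs, hmono⟩ := exists_monotone_finset_function hκ hC.1
  refine ⟨g, fun a => hC.1.1 (hgC a), fun M hM hcl => ?_⟩
  have e : M = ZFSet.sUnion (finImage s g M) := by
    ext z
    rw [ZFSet.mem_sUnion]
    constructor
    · exact fun hz => ⟨_, mem_finImage.2 ⟨{z}, isFinSub_singleton s hz, rfl⟩,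
        hgs _ z (Finset.mem_singleton_self z) (hM.1 hz)⟩
    · rintro ⟨y, hy, hz⟩
      obtain ⟨a, ha, rfl⟩ := mem_finImage.1 hy
      exact hcl a ha hz
  rw [e]
  by_cases hs : s
  · refine hC.2 _ (ZFSet.nonempty_of_mem (mem_finImage.2 ⟨∅, isFinSub_empty s M, rfl⟩)) ?_
      (card_finImage_lt hκ.aleph0_le hM.2) (fun h => absurd hs h)
    intro x hx
    obtain ⟨a, -, rfl⟩ := mem_finImage.1 hx
    exact hgC a
  · obtain rfl : s = False := eq_false hs
    exact sUnion_finImage_mem (fun D h1 h2 h3 h4 => hC.2 D h1 h2 h3 fun _ => h4) hgC hmono M hM.2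

/-! ### Operations on clubs -/

theorem IsClubOfKind.inter {s : Prop} {κ : Cardinal.{u}} (hκ : κ.IsRegular) (hκ' : ℵ₀ < κ)
    {X : ZFSet.{u}} {C C' : Set ZFSet.{u}} (hC : IsClubOfKind s κ X C)
    (hC' : IsClubOfKind s κ X C') : IsClubOfKind s κ X (C ∩ C') := by
  obtain ⟨g, hg, hgC⟩ := hC.exists_closedUnder_subset hκ
  obtain ⟨g', hg', hgC'⟩ := hC'.exists_closedUnder_subset hκ
  refine ⟨⟨fun x hx => hC.1.1 hx.1, fun x hx => ?_⟩, fun D h1 h2 h3 h4 =>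
    ⟨hC.2 D h1 (fun x hx => (h2 x hx).1) h3 h4, hC'.2 D h1 (fun x hx => (h2 x hx).2) h3 h4⟩⟩
  -- Closure under the pointwise union of the two generating functions lands in both clubs.
  obtain ⟨M, hM, hxM, hcl⟩ := exists_closedUnder (s := s) (g := fun a => g a ∪ g' a) hκ hκ'
    (fun a => union_mem_Pk hκ'.le (hg a) (hg' a)) hx
  exact ⟨M, ⟨hgC M hM fun a ha z hz => hcl a ha (ZFSet.mem_union.2 (.inl hz)),
    hgC' M hM fun a ha z hz => hcl a ha (ZFSet.mem_union.2 (.inr hz))⟩, hxM⟩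

theorem isClubOfKind_superset (s : Prop) {κ : Cardinal.{u}} (hκ : κ.IsRegular) {X x : ZFSet.{u}}
    (hx : x ∈ Pk κ X) : IsClubOfKind s κ X {M | M ∈ Pk κ X ∧ x ⊆ M} := by
  refine ⟨⟨fun M hM => hM.1, fun y hy => ⟨x ∪ y, ⟨union_mem_Pk hκ.aleph0_le hx hy, ?_⟩, ?_⟩⟩,
    fun D h1 h2 h3 _ => ⟨sUnion_mem_Pk hκ h3 fun x hx => (h2 x hx).1, ?_⟩⟩
  · exact fun z hz => ZFSet.mem_union.2 (.inl hz)
  · exact fun z hz => ZFSet.mem_union.2 (.inr hz)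
  · obtain ⟨N, hN⟩ := h1
    exact fun z hz => ZFSet.mem_sUnion.2 ⟨N, hN, (h2 N hN).2 hz⟩

theorem isClubOfKind_mem (s : Prop) {κ : Cardinal.{u}} (hκ : κ.IsRegular) {X z : ZFSet.{u}}
    (hz : z ∈ X) : IsClubOfKind s κ X {M | M ∈ Pk κ X ∧ z ∈ M} := by
  convert isClubOfKind_superset s hκ (singleton_mem_Pk hκ.aleph0_le hz) using 3
  refine and_congr_right fun _ => ?_
  exact ⟨fun h y hy => by rwa [ZFSet.mem_singleton.1 hy], fun h => h (ZFSet.mem_singleton.2 rfl)⟩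

-- Closure under a unary function survives arbitrary unions, so this family is a club of either
-- kind.
open Classical in
theorem isClubOfKind_forall_subset (s : Prop) {κ : Cardinal.{u}} (hκ : κ.IsRegular) (hκ' : ℵ₀ < κ)
    {X : ZFSet.{u}} {F : ZFSet.{u} → ZFSet.{u}} (hF : ∀ z ∈ X, F z ∈ Pk κ X) :
    IsClubOfKind s κ X {M | M ∈ Pk κ X ∧ ∀ z ∈ M, F z ⊆ M} := by
  refine ⟨⟨fun M hM => hM.1, fun x hx => ?_⟩, fun D h1 h2 h3 _ =>
    ⟨sUnion_mem_Pk hκ h3 fun x hx => (h2 x hx).1, fun z hz w hw => ?_⟩⟩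
  · obtain ⟨M, hM, hxM, hcl⟩ := exists_closedUnder (s := s) (X := X)
      (g := fun a => if h : ∃ z ∈ X, a = {z} then F h.choose else ∅) hκ hκ' (fun a => by
        split_ifs with h
        · exact hF _ h.choose_spec.1
        · exact empty_mem_Pk hκ'.le X) hx
    refine ⟨M, ⟨hM, fun z hz => ?_⟩, hxM⟩
    have h : ∃ w ∈ X, ({z} : Finset ZFSet.{u}) = {w} := ⟨z, hM.1 hz, rfl⟩
    have := hcl {z} (isFinSub_singleton s hz)
    beta_reduce at this
    rw [dif_pos h] at this
    rwa [← Finset.singleton_injective h.choose_spec.2] at this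
  · obtain ⟨N, hN, hz⟩ := ZFSet.mem_sUnion.1 hz
    exact ZFSet.mem_sUnion.2 ⟨N, hN, (h2 N hN).2 z hz hw⟩

theorem isClubOfKind_forall_mem (s : Prop) {κ : Cardinal.{u}} (hκ : κ.IsRegular) (hκ' : ℵ₀ < κ)
    {X : ZFSet.{u}} {F : ZFSet.{u} → ZFSet.{u}} (hF : ∀ z ∈ X, F z ∈ X) :
    IsClubOfKind s κ X {M | M ∈ Pk κ X ∧ ∀ z ∈ M, F z ∈ M} := by
  convert isClubOfKind_forall_subset s hκ hκ' (F := fun z => {F z})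
    (fun z hz => singleton_mem_Pk hκ'.le (hF z hz)) using 3
  refine and_congr_right fun _ => forall₂_congr fun z _ => ?_
  exact ⟨fun h y hy => by rwa [ZFSet.mem_singleton.1 hy], fun h => h (ZFSet.mem_singleton.2 rfl)⟩

-- A binary operation needs both arguments in one member of the family. Chains provide this,
-- arbitrary unions do not; hence only the kind `False`.
open Classical in
theorem isClubOfKind_inter_mem {κ : Cardinal.{u}} (hκ : κ.IsRegular) (hκ' : ℵ₀ < κ)
    {X : ZFSet.{u}} (hX : ∀ y ∈ X, ∀ z ∈ X, y ∩ z ∈ X) :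
    IsClubOfKind False κ X {M | M ∈ Pk κ X ∧ ∀ y ∈ M, ∀ z ∈ M, y ∩ z ∈ M} := by
  refine ⟨⟨fun M hM => hM.1, fun x hx => ?_⟩, fun D h1 h2 h3 h4 =>
    ⟨sUnion_mem_Pk hκ h3 fun x hx => (h2 x hx).1, fun y hy z hz => ?_⟩⟩
  · obtain ⟨M, hM, hxM, hcl⟩ := exists_closedUnder (s := False) (X := X)
      (g := fun a => if h : ∃ y ∈ X, ∃ z ∈ X, a = {y, z} then
        {h.choose ∩ h.choose_spec.2.choose} else ∅) hκ hκ' (fun a => by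
        split_ifs with h
        · exact singleton_mem_Pk hκ'.le
            (hX _ h.choose_spec.1 _ h.choose_spec.2.choose_spec.1)
        · exact empty_mem_Pk hκ'.le X) hx
    refine ⟨M, ⟨hM, fun y hy z hz => ?_⟩, hxM⟩
    have h : ∃ y' ∈ X, ∃ z' ∈ X, ({y, z} : Finset ZFSet.{u}) = {y', z'} :=
      ⟨y, hM.1 hy, z, hM.1 hz, rfl⟩
    have := hcl {y, z} ⟨fun w hw => by
      rcases Finset.mem_insert.1 hw with rfl | hw
      · exact hy
      · rwa [Finset.mem_singleton.1 hw], False.elim⟩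
    beta_reduce at this
    rw [dif_pos h] at this
    have h' := this (ZFSet.mem_singleton.2 rfl)
    convert h' using 1
    -- The pair recovered by choice from `{y, z}` may come in the other order; its intersection is
    -- the same.
    have h3 := h.choose_spec.2.choose_spec.2
    generalize h.choose_spec.2.choose = z' at *
    generalize h.choose = y' at *
    have e1 : ∀ w, (w = y ∨ w = z) ↔ (w = y' ∨ w = z') := fun w => by
      simpa using Finset.ext_iff.1 h3 w
    ext w
    rw [ZFSet.mem_inter, ZFSet.mem_inter]
    constructor
    · rintro ⟨ha, hb⟩
      refine ⟨?_, ?_⟩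
      · rcases (e1 y').2 (.inl rfl) with rfl | rfl <;> assumption
      · rcases (e1 z').2 (.inr rfl) with rfl | rfl <;> assumption
    · rintro ⟨ha, hb⟩
      refine ⟨?_, ?_⟩
      · rcases (e1 y).1 (.inl rfl) with rfl | rfl <;> assumption
      · rcases (e1 z).1 (.inr rfl) with rfl | rfl <;> assumption
  · obtain ⟨N, hN, hy⟩ := ZFSet.mem_sUnion.1 hy
    obtain ⟨N', hN', hz⟩ := ZFSet.mem_sUnion.1 hz
    rcases h4 not_false N hN N' hN' with h | h
    · exact ZFSet.mem_sUnion.2 ⟨N', hN', (h2 N' hN').2 y (h hy) z hz⟩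
    · exact ZFSet.mem_sUnion.2 ⟨N, hN, (h2 N hN).2 y hy z (h hz)⟩

/-- The family of all sets in `P_κ X'` whose trace on `X` is in a given club. -/
theorem IsClubOfKind.lift {s : Prop} {κ : Cardinal.{u}} (hκ : κ.IsRegular) {X X' : ZFSet.{u}}
    (hX : X ⊆ X') {C : Set ZFSet.{u}} (hC : IsClubOfKind s κ X C) :
    IsClubOfKind s κ X' {M | M ∈ Pk κ X' ∧ M ∩ X ∈ C} := by
  classical
  refine ⟨⟨fun M hM => hM.1, fun x hx => ?_⟩, fun D h1 h2 h3 h4 =>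
    ⟨sUnion_mem_Pk hκ h3 fun x hx => (h2 x hx).1, ?_⟩⟩
  · obtain ⟨N, hN, hxN⟩ := hC.1.2 _ (inter_mem_Pk (X := X) hx.2)
    refine ⟨x ∪ N, ⟨union_mem_Pk hκ.aleph0_le hx (Pk_mono le_rfl hX (hC.1.1 hN)), ?_⟩,
      fun z hz => ZFSet.mem_union.2 (.inl hz)⟩
    convert hN using 1
    ext z
    rw [ZFSet.mem_inter, ZFSet.mem_union]
    refine ⟨?_, fun h => ⟨.inr h, (hC.1.1 hN).1 h⟩⟩
    rintro ⟨h | h, hz⟩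
    · exact hxN (ZFSet.mem_inter.2 ⟨h, hz⟩)
    · exact h
  · have hmem : ∀ y, y ∈ ZFSet.range (fun x : D => x.1 ∩ X) ↔ ∃ x ∈ D, x ∩ X = y := fun y => by
      rw [ZFSet.mem_range]
      exact ⟨fun ⟨x, hx⟩ => ⟨x.1, x.2, hx⟩, fun ⟨x, hx, h⟩ => ⟨⟨x, hx⟩, h⟩⟩
    convert hC.2 (ZFSet.range (fun x : D => x.1 ∩ X)) ?_ ?_ (card_range_lt h3) ?_ using 1
    · ext z
      simp only [ZFSet.mem_inter, ZFSet.mem_sUnion, hmem]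
      constructor
      · rintro ⟨⟨x, hx, hz⟩, hzX⟩
        exact ⟨_, ⟨x, hx, rfl⟩, ZFSet.mem_inter.2 ⟨hz, hzX⟩⟩
      · rintro ⟨_, ⟨x, hx, rfl⟩, hz⟩
        exact ⟨⟨x, hx, (ZFSet.mem_inter.1 hz).1⟩, (ZFSet.mem_inter.1 hz).2⟩
    · obtain ⟨x, hx⟩ := h1
      exact ZFSet.nonempty_of_mem ((hmem _).2 ⟨x, hx, rfl⟩)
    · intro y hy
      obtain ⟨x, hx, rfl⟩ := (hmem y).1 hy
      exact (h2 x hx).2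
    · intro hs y hy y' hy'
      obtain ⟨x, hx, rfl⟩ := (hmem y).1 hy
      obtain ⟨x', hx', rfl⟩ := (hmem y').1 hy'
      have aux : ∀ {a b : ZFSet.{u}}, a ⊆ b → a ∩ X ⊆ b ∩ X := fun h z hz =>
        ZFSet.mem_inter.2 ⟨h (ZFSet.mem_inter.1 hz).1, (ZFSet.mem_inter.1 hz).2⟩
      exact (h4 hs x hx x' hx').imp aux aux

/-- The projection of a club of `P_κ X'` to `P_κ X` contains a club of the same kind. -/
theorem IsClubOfKind.exists_projection {s : Prop} {κ : Cardinal.{u}} (hκ : κ.IsRegular)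
    (hκ' : ℵ₀ < κ) {X X' : ZFSet.{u}} (hX : X ⊆ X') {C : Set ZFSet.{u}}
    (hC : IsClubOfKind s κ X' C) :
    ∃ C', IsClubOfKind s κ X C' ∧ ∀ M ∈ C', ∃ M' ∈ C, M' ∩ X = M := by
  classical
  obtain ⟨g, hg, hgC⟩ := hC.exists_closedUnder_subset hκ
  -- The least `g`-closed set containing `a ∩ X'`. The club on `X` consists of the `M` closed under
  -- `a ↦ cl a ∩ X`; the union of the `cl a` for admissible `a ⊆ M` is then `g`-closed with trace
  -- exactly `M`.
  let cl : Finset ZFSet.{u} → ZFSet.{u} := fun a =>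
    ZFSet.sep (fun z => ∀ M ∈ Pk κ X', ClosedUnder s g M → (∀ w ∈ a, w ∈ X' → w ∈ M) → z ∈ M) X'
  have hcl_sub : ∀ a M, M ∈ Pk κ X' → ClosedUnder s g M → (∀ w ∈ a, w ∈ X' → w ∈ M) → cl a ⊆ M :=
    fun a M h1 h2 h3 z hz => (ZFSet.mem_sep.1 hz).2 M h1 h2 h3
  have hcl_mem : ∀ a, cl a ∈ Pk κ X' := by
    intro a
    obtain ⟨M, hM, haM, hcl⟩ := exists_closedUnder (s := s) hκ hκ' hg (x := ZFSet.sep (· ∈ a) X')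
      ⟨ZFSet.sep_subset, card_sep_finset_lt hκ'.le X' a⟩
    exact ⟨ZFSet.sep_subset, (ZFSet.card_mono (hcl_sub a M hM hcl fun w hw hX =>
      haM (ZFSet.mem_sep.2 ⟨hX, hw⟩))).trans_lt hM.2⟩
  have hcl_closed : ∀ a, ClosedUnder s g (cl a) := fun a b hb z hz =>
    ZFSet.mem_sep.2 ⟨(hg b).1 hz, fun M h1 h2 h3 => h2 b (hb.mono (hcl_sub a M h1 h2 h3)) hz⟩
  have hcl_self : ∀ a, ∀ w ∈ a, w ∈ X' → w ∈ cl a := fun a w hw hX' =>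
    ZFSet.mem_sep.2 ⟨hX', fun M _ _ h3 => h3 w hw hX'⟩
  have hcl_mono : ∀ a b, a ⊆ b → cl a ⊆ cl b := fun a b hab =>
    hcl_sub a _ (hcl_mem b) (hcl_closed b) fun w hw => hcl_self b w (hab hw)
  refine ⟨_, isClubOfKind_closedUnder s hκ hκ' (g := fun a => cl a ∩ X)
    (fun a => inter_mem_Pk (hcl_mem a).2), ?_⟩
  rintro M ⟨hM, hMcl⟩
  refine ⟨ZFSet.sUnion (finImage s cl M), hgC _ (sUnion_mem_Pk hκ
    (card_finImage_lt hκ'.le hM.2) ?_) ?_, ?_⟩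
  · intro x hx
    obtain ⟨a, -, rfl⟩ := mem_finImage.1 hx
    exact hcl_mem a
  · intro b hb z hz
    obtain ⟨N, hN, hbN⟩ := IsFinSub.exists_of_directed (s := s) (a := b)
      (D := (finImage s cl M : Set ZFSet.{u}))
      ⟨_, mem_finImage.2 ⟨∅, isFinSub_empty s M, rfl⟩⟩ (fun hs x hx y hy => by
        obtain ⟨a, ha, rfl⟩ := mem_finImage.1 hx
        obtain ⟨a', ha', rfl⟩ := mem_finImage.1 hy
        refine ⟨cl (a ∪ a'), mem_finImage.2 ⟨a ∪ a', ⟨fun w hw => ?_, fun h => absurd h hs⟩, rfl⟩,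
          hcl_mono _ _ Finset.subset_union_left, hcl_mono _ _ Finset.subset_union_right⟩
        rcases Finset.mem_union.1 hw with h | h
        exacts [ha.1 w h, ha'.1 w h])
      (fun w hw => by simpa using hb.1 w hw) hb.2
    obtain ⟨a, ha, rfl⟩ := mem_finImage.1 hN
    exact ZFSet.mem_sUnion.2 ⟨_, hN, hcl_closed a b hbN hz⟩
  · ext z
    rw [ZFSet.mem_inter, ZFSet.mem_sUnion]
    constructor
    · rintro ⟨⟨y, hy, hz⟩, hzX⟩
      obtain ⟨a, ha, rfl⟩ := mem_finImage.1 hy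
      exact hMcl a ha (ZFSet.mem_inter.2 ⟨hz, hzX⟩)
    · exact fun hz => ⟨⟨_, mem_finImage.2 ⟨{z}, isFinSub_singleton s hz, rfl⟩,
        hcl_self _ z (Finset.mem_singleton_self z) (hX (hM.1 hz))⟩, hM.1 hz⟩

/-! ### The sets `H(θ)` -/

theorem mem_H_of_subset {θ : Cardinal.{u}} {x y : ZFSet.{u}} (hx : x ∈ H θ) (hy : y ⊆ x) :
    y ∈ H θ := by
  obtain ⟨t, ht, hxt, hc⟩ := mem_H.1 hx
  exact mem_H.2 ⟨t, ht, fun z hz => hxt (hy hz), hc⟩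

theorem mem_H_of_mem {θ : Cardinal.{u}} {x y : ZFSet.{u}} (hx : x ∈ H θ) (hy : y ∈ x) :
    y ∈ H θ := by
  obtain ⟨t, ht, hxt, hc⟩ := mem_H.1 hx
  exact mem_H.2 ⟨t, ht, ht.subset_of_mem (hxt hy), hc⟩

theorem H_mono {θ θ' : Cardinal.{u}} (h : θ ≤ θ') : H θ ⊆ H θ' := by
  intro x hx
  obtain ⟨t, ht, hxt, hc⟩ := mem_H.1 hx
  exact mem_H.2 ⟨t, ht, hxt, hc.trans_le h⟩

theorem exists_forall_mem_H (X : ZFSet.{u}) : ∃ θ₀ : Cardinal.{u}, ∀ θ, θ₀ ≤ θ → X ∈ H θ :=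
  ⟨Order.succ (ZFSet.vonNeumann X.rank).card, fun _ h => mem_H.2
    ⟨_, ZFSet.isTransitive_vonNeumann _, ZFSet.subset_vonNeumann_self X, Order.succ_le_iff.1 h⟩⟩

theorem card_cardSet (lam : Cardinal.{u}) : (cardSet lam).card = lam := by
  rw [cardSet, Ordinal.card_toZFSet, Cardinal.card_ord]

theorem cardSet_mem_H {lam θ : Cardinal.{u}} (h : lam < θ) : cardSet lam ∈ H θ :=
  mem_H.2 ⟨_, (ZFSet.isOrdinal_toZFSet _).isTransitive, fun _ h => h, by
    exact (card_cardSet lam).trans_lt h⟩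

theorem cardSet_subset_H (θ : Cardinal.{u}) : cardSet θ ⊆ H θ := by
  intro x hx
  obtain ⟨a, ha, rfl⟩ := Ordinal.mem_toZFSet_iff.1 hx
  refine mem_H.2 ⟨_, (ZFSet.isOrdinal_toZFSet a).isTransitive, fun _ h => h, ?_⟩
  rw [Ordinal.card_toZFSet]
  exact Cardinal.lt_ord.1 ha

theorem le_card_H (θ : Cardinal.{u}) : θ ≤ (H θ).card :=
  (card_cardSet θ).symm.le.trans (ZFSet.card_mono (cardSet_subset_H θ))

/-! ### The principles for clubs and for strong clubs, treated uniformly -/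

/-- `S` is weakly stationary if `s` holds, and stationary otherwise. -/
def IsStationaryOfKind (s : Prop) (κ : Cardinal.{u}) (X : ZFSet.{u}) (S : Set ZFSet.{u}) : Prop :=
  S ⊆ Pk κ X ∧ ∀ C, IsClubOfKind s κ X C → (C ∩ S).Nonempty

theorem isStationaryOfKind_false {κ : Cardinal.{u}} {X : ZFSet.{u}} {S : Set ZFSet.{u}} :
    IsStationaryOfKind False κ X S ↔ IsStationaryFamily κ X S := by
  simp only [IsStationaryOfKind, IsStationaryFamily, isClubOfKind_false]

theorem isStationaryOfKind_true {κ : Cardinal.{u}} {X : ZFSet.{u}} {S : Set ZFSet.{u}} :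
    IsStationaryOfKind True κ X S ↔ IsWeaklyStationaryFamily κ X S := by
  simp only [IsStationaryOfKind, IsWeaklyStationaryFamily, isClubOfKind_true]

theorem isStationaryOfKind_Pk (s : Prop) {κ : Cardinal.{u}} (hκ : ℵ₀ ≤ κ) (X : ZFSet.{u}) :
    IsStationaryOfKind s κ X (Pk κ X) := by
  refine ⟨fun _ h => h, fun C hC => ?_⟩
  obtain ⟨y, hy, -⟩ := hC.1.2 ∅ (empty_mem_Pk hκ X)
  exact ⟨y, hy, hC.1.1 hy⟩

/-- The list `D` is strongly `μ`-`Y`-slender if `s` holds, and `μ`-`Y`-slender otherwise. -/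
def SlenderOfKind (s : Prop) (μ κ : Cardinal.{u}) (X : ZFSet.{u}) (Y : Set ZFSet.{u})
    (D : ZFSet.{u} → ZFSet.{u}) : Prop :=
  ∃ θ₀ : Cardinal.{u}, ∀ θ : Cardinal.{u}, θ₀ ≤ θ → (s → θ.IsRegular) →
    ∃ C, IsClubOfKind s κ (H θ) C ∧
    ∀ M ∈ C, ∀ y ∈ M, y ∈ Pk μ X → M ∩ X ∈ Y → ∃ e ∈ M, D (M ∩ X) ∩ y = e ∩ y

/-- On a club one may assume `M` closed under binary intersection, so a witness `e ∈ M` gives `e ∩ y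
∈ M`, and the two forms of slenderness coincide. -/
theorem slenderOfKind_false {μ κ : Cardinal.{u}} (hκ : κ.IsRegular) (hκ' : ℵ₀ < κ) {X : ZFSet.{u}}
    {Y : Set ZFSet.{u}} {D : ZFSet.{u} → ZFSet.{u}} :
    SlenderOfKind False μ κ X Y D ↔ Slender μ κ X Y D := by
  constructor
  · rintro ⟨θ₀, h⟩
    refine ⟨θ₀, fun θ hθ => ?_⟩
    obtain ⟨C, hC, hD⟩ := h θ hθ False.elim
    refine ⟨_, isClubOfKind_false.1 (hC.inter hκ hκ' (isClubOfKind_inter_mem hκ hκ'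
      fun y hy z _ => mem_H_of_subset hy fun w hw => (ZFSet.mem_inter.1 hw).1)), ?_⟩
    rintro M ⟨hM, -, hM'⟩ y hy hyμ hMY
    obtain ⟨e, he, h⟩ := hD M hM y hy hyμ hMY
    rw [h]
    exact hM' e he y hy
  · rintro ⟨θ₀, h⟩
    refine ⟨θ₀, fun θ hθ _ => ?_⟩
    obtain ⟨C, hC, hD⟩ := h θ hθ
    refine ⟨C, isClubOfKind_false.2 hC, fun M hM y hy hyμ hMY => ⟨_, hD M hM y hy hyμ hMY, ?_⟩⟩
    ext z
    simp only [ZFSet.mem_inter]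
    tauto

theorem slenderOfKind_true {μ κ : Cardinal.{u}} {X : ZFSet.{u}}
    {Y : Set ZFSet.{u}} {D : ZFSet.{u} → ZFSet.{u}} :
    SlenderOfKind True μ κ X Y D ↔ StronglySlender μ κ X Y D := by
  simp only [SlenderOfKind, StronglySlender, isClubOfKind_true, true_implies]

/-- `wSP_Y(μ, κ, X)` if `s` holds, and `SP_Y(μ, κ, X)` otherwise. -/
def SPOfKind (s : Prop) (Y : Set ZFSet.{u}) (μ κ : Cardinal.{u}) (X : ZFSet.{u}) : Prop :=
  ∀ D, IsList κ X D → SlenderOfKind s μ κ X Y D → ∃ d, IsCofinalBranch κ X D d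

theorem spOfKind_false {μ κ : Cardinal.{u}} (hκ : κ.IsRegular) (hκ' : ℵ₀ < κ) {X : ZFSet.{u}}
    {Y : Set ZFSet.{u}} : SPOfKind False Y μ κ X ↔ SP Y μ κ X := by
  simp only [SPOfKind, SP, slenderOfKind_false hκ hκ']

theorem spOfKind_true {μ κ : Cardinal.{u}} {X : ZFSet.{u}} {Y : Set ZFSet.{u}} :
    SPOfKind True Y μ κ X ↔ WSP Y μ κ X := by
  simp only [SPOfKind, WSP, slenderOfKind_true]

/-- `wAGP_Y(μ, κ, θ)` if `s` holds, and `AGP_Y(μ, κ, θ)` otherwise. -/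
def AGPOfKind (s : Prop) (Y : Set ZFSet.{u}) (μ κ θ : Cardinal.{u}) : Prop :=
  ∀ S, IsCofinalFamily κ (H θ) S → ∀ x ∈ H θ,
    IsStationaryOfKind s κ (H θ) {M | M ∈ Pk κ (H θ) ∧ M ∈ Y ∧ AlmostGuessed μ S M x}

theorem agpOfKind_false {Y : Set ZFSet.{u}} {μ κ θ : Cardinal.{u}} :
    AGPOfKind False Y μ κ θ ↔ AGP Y μ κ θ := by
  simp only [AGPOfKind, AGP, isStationaryOfKind_false]

theorem agpOfKind_true {Y : Set ZFSet.{u}} {μ κ θ : Cardinal.{u}} :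
    AGPOfKind True Y μ κ θ ↔ WAGP Y μ κ θ := by
  simp only [AGPOfKind, WAGP, isStationaryOfKind_true]

/-! ### From slender tree properties to almost guessing -/

open Classical in
theorem agpOfKind_of_spOfKind {s : Prop} {μ κ θ : Cardinal.{u}} (hμκ : μ ≤ κ) (hκ : κ.IsRegular)
    (hκ' : ℵ₀ < κ) {Y : Set ZFSet.{u}} (hY : IsStationaryOfKind s κ (H θ) Y)
    (hSP : SPOfKind s Y μ κ (H θ)) : AGPOfKind s Y μ κ θ := by
  intro S hS x hx
  refine ⟨fun M hM => hM.1, fun C₀ hC₀ => ?_⟩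
  by_contra hne
  have hC := hC₀.inter hκ hκ' (isClubOfKind_mem s hκ hx)
  set C := C₀ ∩ {M | M ∈ Pk κ (H θ) ∧ x ∈ M}
  have hd : ∀ M, M ∈ C ∩ Y → ∃ d, d ⊆ x ∧ Approximated μ M x d ∧
      ∀ N ∈ S, x ∈ N → N ⊆ M → ¬ Guessed N d := by
    rintro M ⟨⟨hM, hMP, hxM⟩, hMY⟩
    by_contra! hcon
    exact hne ⟨M, hM, hMP, hMY, hxM, hcon⟩
  choose! d hdx hda hdg using hd
  -- Bad sets exist only at indices in `C ∩ Y`. Stationarity of `Y` puts every other `z` below such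
  -- an index, whose bad set is then cut down to `z`.
  have hm : ∀ z, z ∈ Pk κ (H θ) → ∃ M, M ∈ C ∩ Y ∧ z ⊆ M ∧ (z ∈ C ∩ Y → M = z) := by
    intro z hz
    by_cases hzC : z ∈ C ∩ Y
    · exact ⟨z, hzC, fun _ h => h, fun _ => rfl⟩
    · obtain ⟨M, ⟨hM, -, hzM⟩, hMY⟩ := hY.2 _ (hC.inter hκ hκ' (isClubOfKind_superset s hκ hz))
      exact ⟨M, ⟨hM, hMY⟩, hzM, fun h => absurd h hzC⟩
  choose! m hmC hmz hme using hm
  obtain ⟨b, hb, hbr⟩ := hSP (fun z => d (m z) ∩ z)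
    (fun z _ w hw => (ZFSet.mem_inter.1 hw).2) (by
      refine ⟨θ, fun θ' hθ' _ => ?_⟩
      have hsub := H_mono hθ'
      -- Besides having its trace in `C`, `M` should include its elements of size below `κ`, so that
      -- `y ⊆ M`, and be closed under intersection with `x`.
      refine ⟨_, ((hC.lift hκ hsub).inter hκ hκ' (isClubOfKind_forall_subset s hκ hκ'
        (F := fun y => if y.card < κ then y else ∅) fun z hz => ?_)).inter hκ hκ'
        (isClubOfKind_forall_mem s hκ hκ' (F := fun y => y ∩ x) fun z hz =>
          mem_H_of_subset hz fun w hw => (ZFSet.mem_inter.1 hw).1), ?_⟩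
      · split_ifs with h
        · exact ⟨fun w hw => mem_H_of_mem hz hw, h⟩
        · exact empty_mem_Pk hκ'.le _
      · rintro M ⟨⟨⟨hMP, hMC⟩, -, hMsub⟩, -, hMx⟩ y hy hyμ hMY
        have hyM : y ⊆ M := by
          have := hMsub y hy
          rwa [if_pos (hyμ.2.trans_le hμκ)] at this
        have hmM : m (M ∩ H θ) = M ∩ H θ := hme _ (inter_mem_Pk hMP.2) ⟨hMC, hMY⟩
        have hMCY : M ∩ H θ ∈ C ∩ Y := ⟨hMC, hMY⟩
        -- Approximation is available only at subsets of `x`. As `d ⊆ x`, the answer `e` at `y ∩ x`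
        -- turns into the answer `e ∩ x` at `y`.
        obtain ⟨e, he, hde⟩ := hda _ hMCY (y ∩ x)
          (ZFSet.mem_inter.2 ⟨hMx y hy, mem_H_of_subset hx fun w hw => (ZFSet.mem_inter.1 hw).2⟩)
          (inter_mem_Pk hyμ.2)
        refine ⟨e ∩ x, hMx e (ZFSet.mem_inter.1 he).1, ?_⟩
        beta_reduce
        rw [hmM]
        ext w
        have h1 : w ∈ d (M ∩ H θ) → w ∈ x := fun h => hdx _ hMCY h
        have h2 : w ∈ y → w ∈ M ∧ w ∈ H θ := fun h => ⟨hyM h, hyμ.1 h⟩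
        have h3 := ZFSet.ext_iff.1 hde w
        simp only [ZFSet.mem_inter] at h3 ⊢
        tauto)
  -- Testing the branch on singletons suffices, since every list entry is a subset of `x`. This is
  -- what puts `b` into `H θ`.
  have hbx : b ⊆ x := by
    intro w hw
    obtain ⟨z, hz, hwz, he⟩ := hbr {w} (singleton_mem_Pk hκ'.le (hb hw))
    have := (ZFSet.ext_iff.1 he w).1 (ZFSet.mem_inter.2 ⟨hw, ZFSet.mem_singleton.2 rfl⟩)
    exact hdx _ (hmC z hz) (ZFSet.mem_inter.1 (ZFSet.mem_inter.1 this).1).1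
  obtain ⟨N, hN, hsub⟩ := hS.2 ({x} ∪ {b}) (union_mem_Pk hκ'.le (singleton_mem_Pk hκ'.le hx)
    (singleton_mem_Pk hκ'.le (mem_H_of_subset hx hbx)))
  obtain ⟨z, hz, hNz, he⟩ := hbr N (hS.1 hN)
  refine hdg _ (hmC z hz) N hN (hsub (by simp)) (fun w hw => hmz z hz (hNz hw))
    ⟨b, hsub (by simp), ?_⟩
  rw [he]
  ext w
  have : w ∈ N → w ∈ z := fun h => hNz h
  simp only [ZFSet.mem_inter]
  tauto

/-! ### From almost guessing to slender tree properties -/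

theorem spOfKind_of_agpOfKind {s : Prop} {μ κ θ : Cardinal.{u}} (hκ : κ.IsRegular)
    (hκ' : ℵ₀ < κ) {X : ZFSet.{u}} (hX : X ∈ H θ) {Y : Set ZFSet.{u}}
    (hAGP : AGPOfKind s (familyLift κ X (H θ) Y) μ κ θ) : SPOfKind s Y μ κ X := by
  intro D hD ⟨θ₀, hsl⟩
  by_contra! hbr
  have hx : ∀ d, d ⊆ X → ∃ x, x ∈ Pk κ X ∧ ∀ z ∈ Pk κ X, x ⊆ z → d ∩ x ≠ D z ∩ x := by
    intro d hd
    by_contra! h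
    exact hbr d ⟨hd, h⟩
  choose! x hxP hxD using hx
  have hXH : X ⊆ H θ := fun w hw => mem_H_of_mem hX hw
  have hint : ∀ e : ZFSet.{u}, e ∩ X ⊆ X := fun e w hw => (ZFSet.mem_inter.1 hw).2
  have hS := isClubOfKind_forall_subset s hκ hκ' (X := H θ) (F := fun e => x (e ∩ X))
    fun e _ => Pk_mono le_rfl hXH (hxP _ (hint e))
  -- A successor of an infinite cardinal is regular, as strong slenderness demands.
  set θ' := Order.succ (max (max θ₀ θ) ℵ₀)
  have hle : max (max θ₀ θ) ℵ₀ ≤ θ' := Order.le_succ _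
  obtain ⟨C', hC', hsl⟩ := hsl θ' ((le_max_left _ _).trans ((le_max_left _ _).trans hle))
    fun _ => Cardinal.isRegular_succ (le_max_right _ _)
  have hsub : H θ ⊆ H θ' := H_mono ((le_max_right _ _).trans ((le_max_left _ _).trans hle))
  -- The witnesses from slenderness live in `H θ'`; intersecting them with `X` brings them down to
  -- `H θ` without leaving `M`.
  obtain ⟨C, hC, hproj⟩ := (hC'.inter hκ hκ' (isClubOfKind_forall_mem s hκ hκ'
    (F := fun e => e ∩ X) fun e _ => mem_H_of_subset (hsub hX) (hint e))).exists_projection hκ hκ' hsub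
  obtain ⟨_, hMC, hMP, hMY, -, hMg⟩ := (hAGP _ hS.1 X hX).2 C hC
  obtain ⟨M, ⟨hM, -, hMX⟩, rfl⟩ := hproj _ hMC
  have e : M ∩ H θ ∩ X = M ∩ X := by
    ext w
    have : w ∈ X → w ∈ H θ := fun h => hXH h
    simp only [ZFSet.mem_inter]
    tauto
  have hMXP : M ∩ X ∈ Pk κ X := by rw [← e]; exact inter_mem_Pk hMP.2
  obtain ⟨N, ⟨-, hN⟩, -, hNM, c, hcN, hc⟩ := hMg (D (M ∩ X)) (fun w hw => hint M (hD _ hMXP hw)) (by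
    intro z hz hzμ
    obtain ⟨c, hc, hcz⟩ := hsl M hM z (ZFSet.mem_inter.1 hz).1 hzμ (by rw [← e]; exact hMY.2)
    refine ⟨c ∩ X, ZFSet.mem_inter.2 ⟨hMX c hc, mem_H_of_subset hX (hint c)⟩, ?_⟩
    rw [hcz]
    ext w
    have : w ∈ z → w ∈ X := fun h => hzμ.1 h
    simp only [ZFSet.mem_inter]
    tauto)
  have hcN' : x (c ∩ X) ⊆ N := hN c hcN
  have hcX : x (c ∩ X) ⊆ X := (hxP _ (hint c)).1
  refine hxD (c ∩ X) (hint c) (M ∩ X) hMXP (fun w hw => ZFSet.mem_inter.2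
    ⟨(ZFSet.mem_inter.1 (hNM (hcN' hw))).1, hcX hw⟩) ?_
  ext w
  have h1 : w ∈ x (c ∩ X) → w ∈ N ∧ w ∈ X := fun h => ⟨hcN' h, hcX h⟩
  have h2 := ZFSet.ext_iff.1 hc w
  simp only [ZFSet.mem_inter] at h1 h2 ⊢
  tauto

/-! ### Slender tree properties only depend on the cardinality of the underlying set -/

theorem exists_bijection {X X' : ZFSet.{u}} (h : X.card = X'.card) :
    ∃ f f' : ZFSet.{u} → ZFSet.{u}, (∀ z ∈ X, f z ∈ X') ∧ (∀ z ∈ X', f' z ∈ X) ∧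
      (∀ z ∈ X, f' (f z) = z) ∧ ∀ z ∈ X', f (f' z) = z := by
  classical
  obtain ⟨e⟩ : Nonempty (X ≃ X') :=
    ⟨(equivShrink.{u} X).trans ((Cardinal.eq.1 h).some.trans (equivShrink.{u} X').symm)⟩
  refine ⟨fun z => if hz : z ∈ X then e ⟨z, hz⟩ else ∅,
    fun z => if hz : z ∈ X' then e.symm ⟨z, hz⟩ else ∅, fun z hz => ?_, fun z hz => ?_,
    fun z hz => ?_, fun z hz => ?_⟩ <;> simp [hz]

theorem preimage_mem_Pk {κ : Cardinal.{u}} {X X' y : ZFSet.{u}} {f f' : ZFSet.{u} → ZFSet.{u}}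
    (hf : ∀ z ∈ X, f' (f z) = z) (hy : y ∈ Pk κ X') :
    ZFSet.sep (fun z => f z ∈ y) X ∈ Pk κ X := by
  refine ⟨ZFSet.sep_subset, lt_of_le_of_lt ?_ hy.2⟩
  have hmem := fun i : Shrink.{u} (ZFSet.sep (fun z => f z ∈ y) X) =>
    ZFSet.mem_sep.1 ((equivShrink _).symm i).2
  refine Cardinal.mk_le_of_injective (f := fun i => equivShrink y ⟨_, (hmem i).2⟩) ?_
  intro i j hij
  have h := congrArg f' (congrArg (fun z : y => z.1) ((equivShrink y).injective hij))
  beta_reduce at h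
  rw [hf _ (hmem i).1, hf _ (hmem j).1] at h
  exact (equivShrink _).symm.injective (Subtype.ext h)

-- The list is transported along a bijection `f : X → X'` with inverse `f'`. Sets `M` closed under
-- `f`, `f'` and the induced preimage maps have corresponding traces on `X` and `X'`, so slenderness
-- is transported too, and the branch is pulled back.
open Classical in
theorem spOfKind_of_card_eq {s : Prop} {μ κ : Cardinal.{u}} (hκ : κ.IsRegular) (hκ' : ℵ₀ < κ)
    {X X' : ZFSet.{u}} (hXX' : X.card = X'.card) (h : SPOfKind s (Pk κ X') μ κ X') :
    SPOfKind s (Pk κ X) μ κ X := by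
  obtain ⟨f, f', hf, hf', hff', hf'f⟩ := exists_bijection hXX'
  intro D hD ⟨θ₀, hsl⟩
  let F : ZFSet.{u} → ZFSet.{u} := fun y => ZFSet.sep (fun z => f z ∈ y) X
  let G : ZFSet.{u} → ZFSet.{u} := fun y => ZFSet.sep (fun z => f' z ∈ y) X'
  have hF : ∀ z y, z ∈ F y ↔ z ∈ X ∧ f z ∈ y := fun z y => ZFSet.mem_sep
  have hG : ∀ z y, z ∈ G y ↔ z ∈ X' ∧ f' z ∈ y := fun z y => ZFSet.mem_sep
  have hFP : ∀ {ν : Cardinal.{u}} {y}, y ∈ Pk ν X' → F y ∈ Pk ν X := fun hy => preimage_mem_Pk hff' hy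
  have hGP : ∀ {ν : Cardinal.{u}} {y}, y ∈ Pk ν X → G y ∈ Pk ν X' := fun hy => preimage_mem_Pk hf'f hy
  obtain ⟨d, hd, hbr⟩ := h (fun z => G (D (F z))) (fun z hz w hw => by
    obtain ⟨hw, hw'⟩ := (hG _ _).1 hw
    have := ((hF _ _).1 (hD _ (hFP hz) hw')).2
    rwa [hf'f w hw] at this) (by
    obtain ⟨θ₁, h₁⟩ := exists_forall_mem_H X
    obtain ⟨θ₂, h₂⟩ := exists_forall_mem_H X'
    refine ⟨max θ₀ (max θ₁ θ₂), fun θ hθ hreg => ?_⟩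
    obtain ⟨C, hC, hsl⟩ := hsl θ ((le_max_left _ _).trans hθ) hreg
    have hX : X ∈ H θ := h₁ θ ((le_max_left _ _).trans ((le_max_right _ _).trans hθ))
    have hX' : X' ∈ H θ := h₂ θ ((le_max_right _ _).trans ((le_max_right _ _).trans hθ))
    refine ⟨_, (((hC.inter hκ hκ' (isClubOfKind_forall_mem s hκ hκ' (F := F) fun z hz =>
      mem_H_of_subset hX ZFSet.sep_subset)).inter hκ hκ' (isClubOfKind_forall_mem s hκ hκ' (F := G)
      fun z hz => mem_H_of_subset hX' ZFSet.sep_subset)).inter hκ hκ'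
      (isClubOfKind_forall_mem s hκ hκ' (F := fun z => if z ∈ X then f z else z)
      fun z hz => ?_)).inter hκ hκ' (isClubOfKind_forall_mem s hκ hκ'
      (F := fun z => if z ∈ X' then f' z else z) fun z hz => ?_), ?_⟩
    · split_ifs with h
      exacts [mem_H_of_mem hX' (hf z h), hz]
    · split_ifs with h
      exacts [mem_H_of_mem hX (hf' z h), hz]
    · rintro M ⟨⟨⟨⟨hM, hMP, hMF⟩, -, hMG⟩, -, hMf⟩, -, hMf'⟩ y hy hyμ -
      -- Closure of `M` under `f` and `f'` identifies the index of the new list with that of the old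
      -- one.
      have e : F (M ∩ X') = M ∩ X := by
        ext w
        rw [hF, ZFSet.mem_inter, ZFSet.mem_inter]
        constructor
        · rintro ⟨h1, h2, h3⟩
          have := hMf' _ h2
          rw [if_pos h3, hff' w h1] at this
          exact ⟨this, h1⟩
        · rintro ⟨h1, h2⟩
          have := hMf _ h1
          rw [if_pos h2] at this
          exact ⟨h2, this, hf w h2⟩
      obtain ⟨c, hc, hcy⟩ := hsl M hM (F y) (hMF y hy) (hFP hyμ) (inter_mem_Pk hMP.2)
      refine ⟨G c, hMG c hc, ?_⟩
      beta_reduce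
      rw [e]
      ext w
      rw [ZFSet.mem_inter, ZFSet.mem_inter, hG, hG]
      have h1 := ZFSet.ext_iff.1 hcy (f' w)
      simp only [ZFSet.mem_inter, hF] at h1
      constructor
      · rintro ⟨⟨h2, h3⟩, h4⟩
        exact ⟨⟨h2, (h1.1 ⟨h3, hf' w h2, by rwa [hf'f w h2]⟩).1⟩, h4⟩
      · rintro ⟨⟨h2, h3⟩, h4⟩
        exact ⟨⟨h2, (h1.2 ⟨h3, hf' w h2, by rwa [hf'f w h2]⟩).1⟩, h4⟩)
  refine ⟨F d, ZFSet.sep_subset, fun x hx => ?_⟩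
  obtain ⟨z, hz, hxz, he⟩ := hbr (G x) (hGP hx)
  have hGx : ∀ w ∈ x, f w ∈ G x := fun w hw =>
    (hG _ _).2 ⟨hf w (hx.1 hw), by rwa [hff' w (hx.1 hw)]⟩
  refine ⟨F z, hFP hz, fun w hw => (hF _ _).2 ⟨hx.1 hw, hxz (hGx w hw)⟩, ?_⟩
  ext w
  rw [ZFSet.mem_inter, ZFSet.mem_inter, hF]
  refine and_congr_left fun hw => ?_
  have h1 := ZFSet.ext_iff.1 he (f w)
  have h2 := hGx w hw
  beta_reduce at h1
  rw [ZFSet.mem_inter, ZFSet.mem_inter, hG _ (D (F z)), hff' w (hx.1 hw)] at h1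
  have h3 := hx.1 hw
  have h4 := hf w h3
  tauto

/-! ### The global equivalence -/

theorem familyLift_Pk {κ : Cardinal.{u}} {X X' : ZFSet.{u}} :
    familyLift κ X X' (Pk κ X) = Pk κ X' :=
  Set.ext fun _ => ⟨fun h => h.1, fun h => ⟨h, inter_mem_Pk h.2⟩⟩

theorem lt_of_powerlt_lt {κ lam θ : Cardinal.{u}} (hκ : ℵ₀ < κ) (h : lam ^< κ < θ) : lam < θ := by
  have := Cardinal.le_powerlt lam (Cardinal.one_lt_aleph0.trans hκ)
  rw [Cardinal.power_one] at this
  exact this.trans_lt h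

/-- Forward, take `lam` to be the cardinality of `H θ`, which is at least `θ`, and transport.
Backward, `θ = lam⁺` is regular and `H θ` already contains `lam`. -/
theorem forall_spOfKind_iff_forall_agpOfKind (s : Prop) {μ κ : Cardinal.{u}} (hμκ : μ ≤ κ)
    (hκ : κ.IsRegular) (hκ' : ℵ₀ < κ) :
    (∀ lam : Cardinal.{u}, κ ≤ lam → SPOfKind s (Pk κ (cardSet lam)) μ κ (cardSet lam)) ↔
      ∀ θ : Cardinal.{u}, κ ≤ θ → θ.IsRegular → AGPOfKind s (Pk κ (H θ)) μ κ θ := by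
  constructor
  · intro h θ hθ _
    exact agpOfKind_of_spOfKind hμκ hκ hκ' (isStationaryOfKind_Pk s hκ'.le _)
      (spOfKind_of_card_eq hκ hκ' (card_cardSet _).symm (h _ (hθ.trans (le_card_H θ))))
  · intro h lam hlam
    refine spOfKind_of_agpOfKind hκ hκ' (cardSet_mem_H (Order.lt_succ lam)) ?_
    rw [familyLift_Pk]
    exact h _ (hlam.trans (Order.le_succ lam)) (Cardinal.isRegular_succ (hκ'.le.trans hlam))

end TwoCardinal

open TwoCardinal
theorem theoremA (μ κ : Cardinal.{u}) (hμ : ℵ₀ < μ) (hμκ : μ ≤ κ) (hκ : κ.IsRegular) :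
    -- `SP(μ, κ, ≥ κ)` is equivalent to `AGP(μ, κ, ≥ κ)`
    ((∀ lam : Cardinal.{u}, κ ≤ lam → SP (Pk κ (cardSet lam)) μ κ (cardSet lam)) ↔
      (∀ θ : Cardinal.{u}, κ ≤ θ → θ.IsRegular → AGP (Pk κ (H θ)) μ κ θ)) ∧
    -- `wSP(μ, κ, ≥ κ)` is equivalent to `wAGP(μ, κ, ≥ κ)`
    ((∀ lam : Cardinal.{u}, κ ≤ lam → WSP (Pk κ (cardSet lam)) μ κ (cardSet lam)) ↔
      (∀ θ : Cardinal.{u}, κ ≤ θ → θ.IsRegular → WAGP (Pk κ (H θ)) μ κ θ)) ∧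
    -- the local implications from slender tree properties to almost guessing
    (∀ θ : Cardinal.{u}, κ ≤ θ → θ.IsRegular → ∀ Y : Set ZFSet.{u},
      IsStationaryFamily κ (H θ) Y → SP Y μ κ (H θ) → AGP Y μ κ θ) ∧
    (∀ θ : Cardinal.{u}, κ ≤ θ → θ.IsRegular → ∀ Y : Set ZFSet.{u},
      IsWeaklyStationaryFamily κ (H θ) Y → WSP Y μ κ (H θ) → WAGP Y μ κ θ) ∧
    -- the local implications from almost guessing to slender tree properties
    (∀ lam : Cardinal.{u}, κ ≤ lam → ∀ Y : Set ZFSet.{u}, IsStationaryFamily κ (cardSet lam) Y →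
      (∃ θ : Cardinal.{u}, θ.IsRegular ∧ lam ^< κ < θ ∧
        AGP (familyLift κ (cardSet lam) (H θ) Y) μ κ θ) → SP Y μ κ (cardSet lam)) ∧
    (∀ lam : Cardinal.{u}, κ ≤ lam → ∀ Y : Set ZFSet.{u}, IsWeaklyStationaryFamily κ (cardSet lam) Y →
      (∃ θ : Cardinal.{u}, θ.IsRegular ∧ lam ^< κ < θ ∧
        WAGP (familyLift κ (cardSet lam) (H θ) Y) μ κ θ) → WSP Y μ κ (cardSet lam)) := by
  have hκ' : ℵ₀ < κ := hμ.trans_le hμκ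
  refine ⟨?_, ?_, fun θ _ _ Y hY h => ?_, fun θ _ _ Y hY h => ?_, ?_, ?_⟩
  · simpa only [spOfKind_false hκ hκ', agpOfKind_false] using
      forall_spOfKind_iff_forall_agpOfKind False hμκ hκ hκ'
  · simpa only [spOfKind_true, agpOfKind_true] using
      forall_spOfKind_iff_forall_agpOfKind True hμκ hκ hκ'
  · exact agpOfKind_false.1 (agpOfKind_of_spOfKind hμκ hκ hκ' (isStationaryOfKind_false.2 hY)
      ((spOfKind_false hκ hκ').2 h))
  · exact agpOfKind_true.1 (agpOfKind_of_spOfKind hμκ hκ hκ' (isStationaryOfKind_true.2 hY)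
      (spOfKind_true.2 h))
  · rintro lam _ Y _ ⟨θ, _, hθ, h⟩
    exact (spOfKind_false hκ hκ').1 (spOfKind_of_agpOfKind hκ hκ'
      (cardSet_mem_H (lt_of_powerlt_lt hκ' hθ)) (agpOfKind_false.2 h))
  · rintro lam _ Y _ ⟨θ, _, hθ, h⟩
    exact spOfKind_true.1 (spOfKind_of_agpOfKind hκ hκ'
      (cardSet_mem_H (lt_of_powerlt_lt hκ' hθ)) (agpOfKind_true.2 h))
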